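/- Let $M$ be a connected complex manifold of complex dimension $m$ and let $f : M \to \mathbb{C}^n$ be a holomorphic immersion, so that $M$ is an immersed complex submanifold of $\mathbb{C}^n=\mathbb{R}^{2n}$ whose tangent space at $p$ is the image $\tau_p\subset\mathbb{C}^n$ of the differential $df_p$. Assume that $M$ is full, i.e. $f(M)$ is not contained in any proper complex affine subspace of $\mathbb{C}^n$. Let $d \in \mathbb{C}^n$ be a nonzero vector and assume that $M$ is a helix of angle $\theta$ with respect to $d$, i.e. for every $p\in M$ the angle between $d$ and $\tau_p$ equals $\theta$; this angle is the number in $[0,\pi/2]$ whose cosine is $\|d^{\top}\|/\|d\|$, where $d^{\top}$ is the orthogonal projection of $d$ to $\tau_p$. Then $\theta = 0$, and $M$ is locally an extrinsic product $\mathbb{C}\times N\subset\mathbb{C}\times\mathbb{C}^{n-1}$ with $N$ complex. Precisely: $m\ge 1$, and there is a complex-linear isometry $\psi:\mathbb{C}^n\to\mathbb{C}\times\mathbb{C}^{n-1}$ (onto the orthogonal product) with $\psi(d)=(\|d\|,0)$, such that every $p\in M$ has an open neighbourhood $U\subset M$ for which $f|_U$ is a topological embedding and $\psi(f(U)) = D\times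 N$, where $D\subset\mathbb{C}$ is open and $N\subset\mathbb{C}^{n-1}$ is an embedded complex submanifold of complex dimension $m-1$. -/

import Mathlib

open scoped Manifold ContDiff

noncomputable section

/-- `ℂᵏ` with its standard Hermitian inner product. -/
abbrev CSpace (k : ℕ) : Type := EuclideanSpace ℂ (Fin k)

/-- `f : M → ℂⁿ` is a holomorphic immersion, i.e. it makes the complex manifold `M` of complex
dimension `m` an immersed complex submanifold of `ℂⁿ`. -/
structure IsHolomorphicImmersion (m : ℕ) {n : ℕ} {M : Type*} [TopologicalSpace M]
    [ChartedSpace (CSpace m) M] (f : M → CSpace n) : Prop where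
  holomorphic : MDifferentiable 𝓘(ℂ, CSpace m) 𝓘(ℂ, CSpace n) f
  injective_mfderiv : ∀ p : M,
    Function.Injective (mfderiv 𝓘(ℂ, CSpace m) 𝓘(ℂ, CSpace n) f p)

/-- The tangent space of the immersed submanifold at `p`, as a complex linear subspace of `ℂⁿ`:
the image of the differential of `f` at `p`. -/
def tangentImage (m : ℕ) {n : ℕ} {M : Type*} [TopologicalSpace M] [ChartedSpace (CSpace m) M]
    (f : M → CSpace n) (p : M) : Submodule ℂ (CSpace n) :=
  LinearMap.range
    (mfderiv 𝓘(ℂ, CSpace m) 𝓘(ℂ, CSpace n) f p : CSpace m →L[ℂ] CSpace n).toLinearMap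

/-- The angle in `[0, π/2]` between a vector `d` and the tangent space at `p`: the angle, for the
real inner product `Re ⟪·, ·⟫` of `ℂⁿ = ℝ²ⁿ`, between `d` and its tangential component (and `π/2`
if that component is zero). The tangent space is closed under multiplication by `i`, so
its Hermitian and its real orthogonal projections coincide. -/
def tangentAngle (m : ℕ) {n : ℕ} {M : Type*} [TopologicalSpace M] [ChartedSpace (CSpace m) M]
    (f : M → CSpace n) (d : CSpace n) (p : M) : ℝ :=
  InnerProductGeometry.angle d ((tangentImage m f p).starProjection d)

/-- The immersed submanifold is a helix of angle `θ` with respect to `d`. -/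
def IsHelix (m : ℕ) {n : ℕ} {M : Type*} [TopologicalSpace M] [ChartedSpace (CSpace m) M]
    (f : M → CSpace n) (d : CSpace n) (θ : ℝ) : Prop :=
  ∀ p : M, tangentAngle m f d p = θ

/-- The immersed submanifold is full: no proper complex affine subspace of `ℂⁿ` contains it. -/
def IsFull {n : ℕ} {M : Type*} (f : M → CSpace n) : Prop :=
  ∀ A : AffineSubspace ℂ (CSpace n), Set.range f ⊆ A → A = ⊤

/-- `N ⊆ ℂʳ` is an (embedded) complex submanifold of complex dimension `k`: around each of its
points there is a local biholomorphism of `ℂʳ` that carries `N` to a `k`-dimensional complex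
linear subspace. -/
def IsComplexSubmanifold {r : ℕ} (k : ℕ) (N : Set (CSpace r)) : Prop :=
  ∀ q ∈ N, ∃ Φ : OpenPartialHomeomorph (CSpace r) (CSpace r),
    q ∈ Φ.source ∧
    DifferentiableOn ℂ Φ Φ.source ∧
    DifferentiableOn ℂ Φ.symm Φ.target ∧
    ∃ S : Submodule ℂ (CSpace r), Module.finrank ℂ S = k ∧
      Φ '' (Φ.source ∩ N) = Φ.target ∩ S

/-- The orthogonal product `ℂ × ℂʳ` with its standard Hermitian inner product. -/
abbrev CProd (r : ℕ) : Type := WithLp 2 (ℂ × CSpace r)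

/-- The subset `D × N` of `ℂ × ℂʳ`. -/
def extrinsicProduct {r : ℕ} (D : Set ℂ) (N : Set (CSpace r)) : Set (CProd r) :=
  {z | z.fst ∈ D ∧ z.snd ∈ N}

end

/-! The heart of the matter is that the tangential component `T` of `d` is locally constant. In a
chart write `T = A u`, where `A` is the holomorphic differential of the immersion; `u` is only
real-smooth, so `T` is split by the Wirtinger operators. Since `A` is holomorphic and `T - d` is
normal, `∂̄_X T = A (∂̄_X u)` is tangent, `∂_X T` is normal, and `⟨A v, ∂̄_X T⟩` is symmetric in `X`
and `v` (the second fundamental form paired with `T - d`). The helix condition makes `⟨d, T⟩ = ‖T‖²`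
constant, whence `⟨T, ∂̄_X T⟩ = 0`, and one more differentiation gives `‖∂_X T‖ = ‖∂̄_X T‖`. By
symmetry `∂_u T = 0`; differentiating this identity by `∂̄_X` forces all derivatives of `T` to
vanish (`fderiv_tangential_eq_zero`).

By connectedness `T` is constant on `M`. Then `w = d - T` is a fixed vector normal to every tangent
space, so `⟨w, f⟩` is constant and `f(M)` lies in an affine hyperplane unless `w = 0`. Fullness
gives `w = 0`: the axis is tangent (`IsHelix.mem_tangentImage`) and the angle vanishes.

Once `d` is everywhere tangent, rotate it to the first factor. The inverse function theorem provides
coordinates `(s, w)` in which the second component of `f` does not depend on `s`, so the image is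
locally a disc times the graph-like set `κ '' B` (`exists_adapted_chart`). -/

noncomputable section
universe u

/-! ### Regularity of holomorphic maps of several variables -/

open Metric in
/-- Cauchy's integral formula for the derivative of a holomorphic map along a direction. -/
theorem DifferentiableOn.fderiv_apply_eq_circleIntegral {E F : Type*} [NormedAddCommGroup E]
    [NormedSpace ℂ E] [NormedAddCommGroup F] [NormedSpace ℂ F] [CompleteSpace F]
    {g : E → F} {Ω : Set E} (hΩ : IsOpen Ω) (hg : DifferentiableOn ℂ g Ω) {z v : E} {r : ℝ}
    (hr : 0 < r) (hz : ∀ ζ ∈ closedBall (0 : ℂ) r, z + ζ • v ∈ Ω) :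
    fderiv ℂ g z v =
      (2 * Real.pi * Complex.I : ℂ)⁻¹ • ∮ ζ in C(0, r), (ζ ^ 2)⁻¹ • g (z + ζ • v) := by
  have hline : ∀ ζ : ℂ, HasDerivAt (fun ζ : ℂ => z + ζ • v) v ζ := fun ζ => by
    simpa using ((hasDerivAt_id ζ).smul_const v).const_add z
  have hd : DifferentiableOn ℂ (fun ζ : ℂ => g (z + ζ • v)) (closedBall 0 r) := fun ζ hζ =>
    (((hg _ (hz ζ hζ)).differentiableAt (hΩ.mem_nhds (hz ζ hζ))).comp ζ
      (hline ζ).differentiableAt).differentiableWithinAt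
  have h0 : z + (0 : ℂ) • v ∈ Ω := hz 0 (by simp [hr.le])
  have hder : _root_.deriv (fun ζ : ℂ => g (z + ζ • v)) 0 = fderiv ℂ g z v := by
    have := ((hg _ h0).differentiableAt (hΩ.mem_nhds h0)).hasFDerivAt.comp_hasDerivAt 0 (hline 0)
    simpa [Function.comp_def] using this.deriv
  have h := hd.deriv_eq_smul_circleIntegral hr
  simp only [sub_zero, one_div] at h
  rw [← hder, h, inv_smul_smul₀ Complex.two_pi_I_ne_zero]

open Metric in
/-- Cauchy's estimate for the derivative of a holomorphic map on a ball. -/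
theorem DifferentiableOn.norm_fderiv_le_of_forall_mem_ball {E F : Type*} [NormedAddCommGroup E]
    [NormedSpace ℂ E] [NormedAddCommGroup F] [NormedSpace ℂ F]
    {g : E → F} {z : E} {r C : ℝ} (hg : DifferentiableOn ℂ g (ball z r))
    (hr : 0 < r) (hC : ∀ w ∈ ball z r, ‖g w‖ ≤ C) :
    ‖fderiv ℂ g z‖ ≤ C / (r / 2) := by
  have hC0 : 0 ≤ C := (norm_nonneg _).trans (hC z (mem_ball_self hr))
  refine ContinuousLinearMap.opNorm_le_of_unit_norm (by positivity) fun v hv => ?_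
  have hline : ∀ ζ : ℂ, HasDerivAt (fun ζ : ℂ => z + ζ • v) v ζ := fun ζ => by
    simpa using ((hasDerivAt_id ζ).smul_const v).const_add z
  -- Halving the radius keeps the closed disc inside the open ball where `g` is holomorphic.
  have hmem : ∀ ζ ∈ closedBall (0 : ℂ) (r / 2), z + ζ • v ∈ ball z r := fun ζ hζ => by
    have : ‖ζ‖ ≤ r / 2 := by simpa using hζ
    simp only [mem_ball, dist_self_add_left, norm_smul, hv]
    linarith
  have hd : DifferentiableOn ℂ (fun ζ : ℂ => g (z + ζ • v)) (closedBall 0 (r / 2)) := fun ζ hζ =>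
    (((hg _ (hmem ζ hζ)).differentiableAt (isOpen_ball.mem_nhds (hmem ζ hζ))).comp ζ
      (hline ζ).differentiableAt).differentiableWithinAt
  have h0 : z + (0 : ℂ) • v ∈ ball z r := hmem 0 (by simp [half_pos hr |>.le])
  have hder : _root_.deriv (fun ζ : ℂ => g (z + ζ • v)) 0 = fderiv ℂ g z v := by
    have := ((hg _ h0).differentiableAt
      (isOpen_ball.mem_nhds h0)).hasFDerivAt.comp_hasDerivAt 0 (hline 0)
    simpa [Function.comp_def] using this.deriv
  rw [← hder]
  exact Complex.norm_deriv_le_of_forall_mem_sphere_norm_le (half_pos hr)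
    (hd.mono closure_ball_subset_closedBall).diffContOnCl
    fun ζ hζ => hC _ (hmem ζ (sphere_subset_closedBall hζ))

open Metric MeasureTheory in
/-- The derivative of a holomorphic map of several variables is holomorphic along directions. -/
theorem DifferentiableOn.differentiableOn_fderiv_apply {E F : Type*} [NormedAddCommGroup E]
    [NormedSpace ℂ E] [FiniteDimensional ℂ E] [NormedAddCommGroup F] [NormedSpace ℂ F]
    [FiniteDimensional ℂ F] {g : E → F} {Ω : Set E} (hΩ : IsOpen Ω) (hg : DifferentiableOn ℂ g Ω)
    (v : E) : DifferentiableOn ℂ (fun z => fderiv ℂ g z v) Ω := by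
  have := FiniteDimensional.complete ℂ F
  intro z₀ hz₀
  obtain ⟨δ, hδ, hball⟩ : ∃ δ > 0, ball z₀ δ ⊆ Ω ∩ {z | ‖g z‖ < ‖g z₀‖ + 1} := by
    refine Metric.mem_nhds_iff.1 (Filter.inter_mem (hΩ.mem_nhds hz₀) ?_)
    exact ((hg.continuousOn z₀ hz₀).continuousAt (hΩ.mem_nhds hz₀)).norm.eventually_lt_const
      (lt_add_one _)
  set C := ‖g z₀‖ + 1
  -- One `R` for moving `z`, one for the circle of integration, one for Cauchy's estimate at the
  -- points reached.
  set R := δ / 3 with hR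
  have hR0 : 0 < R := by positivity
  set r := R / (‖v‖ + 1) with hr
  have hr0 : 0 < r := by positivity
  have hrv : r * ‖v‖ ≤ R := by
    rw [hr, div_mul_eq_mul_div, div_le_iff₀ (by positivity)]
    nlinarith [norm_nonneg v]
  have hmem : ∀ z ∈ ball z₀ R, ∀ ζ ∈ closedBall (0 : ℂ) r, z + ζ • v ∈ ball z₀ (2 * R) := by
    intro z hz ζ hζ
    have h1 : ‖ζ‖ ≤ r := by simpa using hζ
    have h2 : ‖z - z₀‖ < R := by simpa [dist_eq_norm] using hz
    have h3 : ‖ζ • v‖ ≤ R := by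
      rw [norm_smul]
      exact (mul_le_mul_of_nonneg_right h1 (norm_nonneg v)).trans hrv
    rw [mem_ball, dist_eq_norm, add_sub_right_comm]
    linarith [norm_add_le (z - z₀) (ζ • v)]
  have hsub : ball z₀ (2 * R) ⊆ ball z₀ δ := ball_subset_ball (by linarith)
  have hΩ' : ∀ z ∈ ball z₀ R, ∀ ζ ∈ closedBall (0 : ℂ) r, z + ζ • v ∈ Ω := fun z hz ζ hζ =>
    (hball (hsub (hmem z hz ζ hζ))).1
  have hbd : ∀ w ∈ ball z₀ (2 * R), ‖fderiv ℂ g w‖ ≤ C / (R / 2) := by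
    intro w hw
    have hs : ball w R ⊆ ball z₀ δ := ball_subset_ball' (by
      have := mem_ball.1 hw
      linarith)
    exact DifferentiableOn.norm_fderiv_le_of_forall_mem_ball
      (hg.mono fun y hy => (hball (hs hy)).1) hR0 fun y hy => (hball (hs hy)).2.le
  have hcm : ∀ t, circleMap 0 r t ∈ closedBall (0 : ℂ) r := fun t =>
    circleMap_mem_closedBall 0 hr0.le t
  have hcm0 : ∀ t, circleMap 0 r t ≠ 0 := fun t => circleMap_ne_center hr0.ne'
  set s : ℝ → ℂ := fun t => _root_.deriv (circleMap 0 r) t * (circleMap 0 r t ^ 2)⁻¹ with hs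
  have hscont : Continuous s := by
    simp only [hs, deriv_circleMap]
    exact ((continuous_circleMap 0 r).mul continuous_const).mul
      (((continuous_circleMap 0 r).pow 2).inv₀ fun t => pow_ne_zero 2 (hcm0 t))
  have hcont : ∀ z ∈ ball z₀ R, Continuous fun t => s t • g (z + circleMap 0 r t • v) := by
    intro z hz
    refine hscont.smul (hg.continuousOn.comp_continuous ?_ fun t => hΩ' z hz _ (hcm t))
    exact continuous_const.add ((continuous_circleMap 0 r).smul continuous_const)
  have hfor : ∀ z ∈ ball z₀ R, fderiv ℂ g z v = (2 * Real.pi * Complex.I : ℂ)⁻¹ •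
      ∫ t in (0)..(2 * Real.pi), s t • g (z + circleMap 0 r t • v) := by
    intro z hz
    rw [hg.fderiv_apply_eq_circleIntegral hΩ hr0 (hΩ' z hz), circleIntegral]
    simp only [hs, mul_smul]
  -- Continuity of the derivative is not yet available; for differentiating under the integral,
  -- measurability of `fderiv` and the bound `hbd` suffice.
  borelize E
  have key := intervalIntegral.hasFDerivAt_integral_of_dominated_of_fderiv_le (𝕜 := ℂ)
    (μ := volume) (a := 0) (b := 2 * Real.pi)
    (F := fun z t => s t • g (z + circleMap 0 r t • v))
    (F' := fun z t => s t • fderiv ℂ g (z + circleMap 0 r t • v)) (x₀ := z₀)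
    (bound := fun t => ‖s t‖ * (C / (R / 2))) (ball_mem_nhds z₀ hR0)
    (Filter.eventually_of_mem (ball_mem_nhds z₀ hR0) fun z hz =>
      (hcont z hz).aestronglyMeasurable)
    ((hcont z₀ (mem_ball_self hR0)).intervalIntegrable _ _)
    (by
      refine hscont.aestronglyMeasurable.smul ?_
      refine Measurable.aestronglyMeasurable ((measurable_fderiv ℂ g).comp ?_)
      exact (continuous_const.add ((continuous_circleMap 0 r).smul continuous_const)).measurable)
    (Filter.Eventually.of_forall fun t _ z hz => by
      rw [norm_smul]
      exact mul_le_mul_of_nonneg_left (hbd _ (hmem z hz _ (hcm t))) (norm_nonneg _))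
    ((hscont.norm.mul continuous_const).intervalIntegrable _ _)
    (Filter.Eventually.of_forall fun t _ z hz => by
      have hw := hΩ' z hz _ (hcm t)
      have h1 := ((hg _ hw).differentiableAt (hΩ.mem_nhds hw)).hasFDerivAt
      have h2 : HasFDerivAt (fun z : E => z + circleMap 0 r t • v) (ContinuousLinearMap.id ℂ E) z :=
        (hasFDerivAt_id z).add_const _
      exact (h1.comp z h2).const_smul (s t))
  refine DifferentiableAt.differentiableWithinAt ?_
  refine (key.differentiableAt.const_smul (2 * Real.pi * Complex.I : ℂ)⁻¹).congr_of_eventuallyEq ?_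
  exact Filter.eventually_of_mem (ball_mem_nhds z₀ hR0) fun z hz => hfor z hz

/-- The derivative of a holomorphic map of several variables is holomorphic. -/
theorem DifferentiableOn.differentiableOn_fderiv {E F : Type*} [NormedAddCommGroup E]
    [NormedSpace ℂ E] [FiniteDimensional ℂ E] [NormedAddCommGroup F] [NormedSpace ℂ F]
    [FiniteDimensional ℂ F] {g : E → F} {Ω : Set E} (hΩ : IsOpen Ω)
    (hg : DifferentiableOn ℂ g Ω) : DifferentiableOn ℂ (fderiv ℂ g) Ω := by
  let d := Module.finrank ℂ E
  have hd : d = Module.finrank ℂ (Fin d → ℂ) := (Module.finrank_fin_fun ℂ).symm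
  let e₁ := ContinuousLinearEquiv.ofFinrankEq hd
  let e₂ := (e₁.arrowCongr (1 : F ≃L[ℂ] F)).trans (ContinuousLinearEquiv.piRing (Fin d))
  rw [← e₂.comp_differentiableOn_iff]
  refine differentiableOn_pi.2 fun i => ?_
  exact hg.differentiableOn_fderiv_apply hΩ _

/-- Holomorphic maps of several variables are smooth. -/
theorem DifferentiableOn.contDiffOn_nat {E F : Type u} [NormedAddCommGroup E]
    [NormedSpace ℂ E] [FiniteDimensional ℂ E] [NormedAddCommGroup F] [NormedSpace ℂ F]
    [FiniteDimensional ℂ F] {g : E → F} {Ω : Set E} (hΩ : IsOpen Ω)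
    (hg : DifferentiableOn ℂ g Ω) (k : ℕ) : ContDiffOn ℂ k g Ω := by
  -- The induction hypothesis is applied to the target `E →L[ℂ] F`, which is why `E` and `F` share a
  -- universe.
  induction k generalizing F with
  | zero => exact contDiffOn_zero.2 hg.continuousOn
  | succ k ih =>
    have := (contDiffOn_succ_iff_fderiv_of_isOpen (𝕜 := ℂ) (f := g) (n := k) hΩ).2
      ⟨hg, by simp, ih (hg.differentiableOn_fderiv hΩ)⟩
    exact_mod_cast this

open Complex Filter Topology
open scoped InnerProductSpace

/-! ### Wirtinger calculus -/

section Wirtinger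

variable {E F G : Type*} [NormedAddCommGroup E] [NormedSpace ℂ E]
  [NormedAddCommGroup F] [NormedSpace ℂ F] [NormedAddCommGroup G] [InnerProductSpace ℂ G]

/-- The Wirtinger derivative `∂_X φ` at `z`. -/
def wirtinger (φ : E → F) (z X : E) : F :=
  (1 / 2 : ℂ) • (fderiv ℝ φ z X - I • fderiv ℝ φ z (I • X))

/-- The conjugate Wirtinger derivative `∂̄_X φ` at `z`. -/
def wirtingerBar (φ : E → F) (z X : E) : F :=
  (1 / 2 : ℂ) • (fderiv ℝ φ z X + I • fderiv ℝ φ z (I • X))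

theorem wirtinger_add_wirtingerBar (φ : E → F) (z X : E) :
    wirtinger φ z X + wirtingerBar φ z X = fderiv ℝ φ z X := by
  unfold wirtinger wirtingerBar
  module

theorem fderiv_real_clm_apply {A : E → F →L[ℂ] G} {u : E → F} {z : E}
    (hA : DifferentiableAt ℂ A z) (hu : DifferentiableAt ℝ u z) (X : E) :
    fderiv ℝ (fun w => A w (u w)) z X = fderiv ℂ A z X (u z) + A z (fderiv ℝ u z X) := by
  have h1 : HasFDerivAt (fun p : E × F => A p.1 p.2) _ (z, u z) :=
    (HasFDerivAt.comp (𝕜 := ℂ) (z, u z) hA.hasFDerivAt hasFDerivAt_fst).clm_apply hasFDerivAt_snd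
  have h2 : HasFDerivAt (fun w => (w, u w)) _ z := (hasFDerivAt_id (𝕜 := ℝ) z).prodMk hu.hasFDerivAt
  have h3 := (h1.restrictScalars ℝ).comp z h2
  have h4 := congrArg (fun L => L X) h3.fderiv
  simp only [Function.comp_def] at h4
  rw [h4]
  simp [add_comm]

theorem DifferentiableAt.clm_apply_real {A : E → F →L[ℂ] G} {u : E → F} {z : E}
    (hA : DifferentiableAt ℂ A z) (hu : DifferentiableAt ℝ u z) :
    DifferentiableAt ℝ (fun w => A w (u w)) z := by
  have h1 : DifferentiableAt ℂ (fun p : E × F => A p.1 p.2) (z, u z) :=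
    (DifferentiableAt.comp (𝕜 := ℂ) (z, u z) hA differentiableAt_fst).clm_apply differentiableAt_snd
  exact (h1.restrictScalars ℝ).comp z (differentiableAt_id.prodMk hu)

theorem wirtinger_clm_apply {A : E → F →L[ℂ] G} {u : E → F} {z : E}
    (hA : DifferentiableAt ℂ A z) (hu : DifferentiableAt ℝ u z) (X : E) :
    wirtinger (fun w => A w (u w)) z X = fderiv ℂ A z X (u z) + A z (wirtinger u z X) := by
  simp only [wirtinger, fderiv_real_clm_apply hA hu, map_smul, map_sub,
    smul_apply, smul_add, smul_smul, I_mul_I]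
  module

/-- The factor `A` is holomorphic, so `∂̄` passes through it. This is what makes `∂̄T` tangent. -/
theorem wirtingerBar_clm_apply {A : E → F →L[ℂ] G} {u : E → F} {z : E}
    (hA : DifferentiableAt ℂ A z) (hu : DifferentiableAt ℝ u z) (X : E) :
    wirtingerBar (fun w => A w (u w)) z X = A z (wirtingerBar u z X) := by
  simp only [wirtingerBar, fderiv_real_clm_apply hA hu, map_smul, map_add,
    smul_apply, smul_add, smul_smul, I_mul_I]
  module

/-- Used for `(∂_u A) u`, in which `u` occurs twice. -/
theorem wirtingerBar_clm_apply₂ {H : Type*} [NormedAddCommGroup H] [NormedSpace ℂ H]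
    {B : E → F →L[ℂ] H →L[ℂ] G} {u : E → F} {v : E → H} {z : E} (hB : DifferentiableAt ℂ B z)
    (hu : DifferentiableAt ℝ u z) (hv : DifferentiableAt ℝ v z) (X : E) :
    wirtingerBar (fun w => B w (u w) (v w)) z X =
      B z (wirtingerBar u z X) (v z) + B z (u z) (wirtingerBar v z X) := by
  have h1 : HasFDerivAt (fun p : E × F × H => B p.1 p.2.1 p.2.2) _ (z, u z, v z) :=
    ((HasFDerivAt.comp (𝕜 := ℂ) (z, u z, v z) hB.hasFDerivAt hasFDerivAt_fst).clm_apply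
      (hasFDerivAt_fst.comp _ hasFDerivAt_snd)).clm_apply (hasFDerivAt_snd.comp _ hasFDerivAt_snd)
  have h2 : HasFDerivAt (fun w => (w, u w, v w)) _ z :=
    (hasFDerivAt_id (𝕜 := ℝ) z).prodMk (hu.hasFDerivAt.prodMk hv.hasFDerivAt)
  have h3 := ((h1.restrictScalars ℝ).comp z h2).fderiv
  simp only [Function.comp_def] at h3
  rw [wirtingerBar, h3]
  simp only [ContinuousLinearMap.coe_restrictScalars', ContinuousLinearMap.comp_apply,
    ContinuousLinearMap.prod_apply, add_apply, ContinuousLinearMap.flip_apply,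
    ContinuousLinearMap.coe_fst', ContinuousLinearMap.coe_snd', ContinuousLinearMap.id_apply,
    map_smul, smul_apply, wirtingerBar, map_add]
  simp only [smul_add, smul_smul, I_mul_I]
  module

theorem wirtinger_const (c : F) (z X : E) : wirtinger (fun _ => c) z X = 0 := by
  simp [wirtinger]

theorem wirtingerBar_const (c : F) (z X : E) : wirtingerBar (fun _ => c) z X = 0 := by
  simp [wirtingerBar]

theorem wirtinger_sub_const (φ : E → F) (c : F) (z X : E) :
    wirtinger (fun w => φ w - c) z X = wirtinger φ z X := by
  simp [wirtinger, fderiv_sub_const]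

theorem wirtingerBar_sub_const (φ : E → F) (c : F) (z X : E) :
    wirtingerBar (fun w => φ w - c) z X = wirtingerBar φ z X := by
  simp [wirtingerBar, fderiv_sub_const]

theorem fderiv_inner_add_eq_zero {φ ψ : E → G} {z : E} {c : ℂ} (hφ : DifferentiableAt ℝ φ z)
    (hψ : DifferentiableAt ℝ ψ z) (h : ∀ᶠ w in 𝓝 z, ⟪φ w, ψ w⟫_ℂ = c) (X : E) :
    ⟪φ z, fderiv ℝ ψ z X⟫_ℂ + ⟪fderiv ℝ φ z X, ψ z⟫_ℂ = 0 := by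
  rw [← fderiv_inner_apply ℂ hφ hψ, EventuallyEq.fderiv_eq (f := fun _ => c) h]
  simp

/-- The inner product is conjugate-linear in its first slot, so `∂` turns into `∂̄` there. -/
theorem inner_wirtinger_add_eq_zero {φ ψ : E → G} {z : E} {c : ℂ} (hφ : DifferentiableAt ℝ φ z)
    (hψ : DifferentiableAt ℝ ψ z) (h : ∀ᶠ w in 𝓝 z, ⟪φ w, ψ w⟫_ℂ = c) (X : E) :
    ⟪φ z, wirtinger ψ z X⟫_ℂ + ⟪wirtingerBar φ z X, ψ z⟫_ℂ = 0 := by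
  have h1 := fderiv_inner_add_eq_zero hφ hψ h X
  have h2 := fderiv_inner_add_eq_zero hφ hψ h (I • X)
  simp only [wirtinger, wirtingerBar, inner_smul_left, inner_smul_right, inner_add_left,
    inner_sub_right, map_div₀, map_one, map_ofNat, conj_I]
  linear_combination (1 / 2 : ℂ) * h1 - (1 / 2 : ℂ) * I * h2

theorem inner_wirtingerBar_add_eq_zero {φ ψ : E → G} {z : E} {c : ℂ} (hφ : DifferentiableAt ℝ φ z)
    (hψ : DifferentiableAt ℝ ψ z) (h : ∀ᶠ w in 𝓝 z, ⟪φ w, ψ w⟫_ℂ = c) (X : E) :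
    ⟪φ z, wirtingerBar ψ z X⟫_ℂ + ⟪wirtinger φ z X, ψ z⟫_ℂ = 0 := by
  have h1 := fderiv_inner_add_eq_zero hφ hψ h X
  have h2 := fderiv_inner_add_eq_zero hφ hψ h (I • X)
  simp only [wirtinger, wirtingerBar, inner_smul_left, inner_smul_right, inner_add_right,
    inner_sub_left, map_div₀, map_one, map_ofNat, conj_I]
  linear_combination (1 / 2 : ℂ) * h1 + (1 / 2 : ℂ) * I * h2

theorem DifferentiableAt.wirtinger {φ : E → F} {z : E} (h : ContDiffAt ℝ 2 φ z) (X : E) :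
    DifferentiableAt ℝ (fun w => wirtinger φ w X) z := by
  have h1 : DifferentiableAt ℝ (fderiv ℝ φ) z :=
    (h.fderiv_right (m := 1) (by norm_num)).differentiableAt (by norm_num)
  unfold _root_.wirtinger
  fun_prop

theorem DifferentiableAt.wirtingerBar {φ : E → F} {z : E} (h : ContDiffAt ℝ 2 φ z) (X : E) :
    DifferentiableAt ℝ (fun w => wirtingerBar φ w X) z := by
  have h1 : DifferentiableAt ℝ (fderiv ℝ φ) z :=
    (h.fderiv_right (m := 1) (by norm_num)).differentiableAt (by norm_num)
  unfold _root_.wirtingerBar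
  fun_prop

/-- Both sides expand into second derivatives in `X` and `I • X`; the mixed ones agree by symmetry.
-/
theorem wirtinger_wirtingerBar_comm {φ : E → F} {z : E} (h : ContDiffAt ℝ 2 φ z) (X : E) :
    wirtinger (fun w => wirtingerBar φ w X) z X = wirtingerBar (fun w => wirtinger φ w X) z X := by
  have h1 : DifferentiableAt ℝ (fderiv ℝ φ) z :=
    (h.fderiv_right (m := 1) (by norm_num)).differentiableAt (by norm_num)
  have hs := (h.isSymmSndFDerivAt (by simp)).eq X (I • X)
  have e : ∀ v : E, HasFDerivAt (fun w => fderiv ℝ φ w v) ((fderiv ℝ (fderiv ℝ φ) z).flip v) z :=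
    fun v => by simpa using h1.hasFDerivAt.clm_apply (hasFDerivAt_const v z)
  have e1 := (((e X).add ((e (I • X)).const_smul I)).const_smul (1 / 2 : ℂ)).fderiv
  have e2 := (((e X).sub ((e (I • X)).const_smul I)).const_smul (1 / 2 : ℂ)).fderiv
  have e1' : fderiv ℝ (fun w => wirtingerBar φ w X) z = _ := e1
  have e2' : fderiv ℝ (fun w => wirtinger φ w X) z = _ := e2
  rw [wirtinger, wirtingerBar, e1', e2']
  simp only [smul_apply, add_apply,
    sub_apply, ContinuousLinearMap.flip_apply, hs]
  module

end Wirtinger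

/-! ### Constancy of the tangential component -/

/-- Let `A` be the differential of a holomorphic map, and let `A u` be the tangential
component of a fixed vector `d`. If its length is constant, then it is a constant vector. -/
theorem fderiv_tangential_eq_zero {E F : Type*} [NormedAddCommGroup E] [NormedSpace ℂ E]
    [NormedAddCommGroup F] [InnerProductSpace ℂ F] {Ω : Set E} (hΩ : IsOpen Ω)
    {A : E → E →L[ℂ] F} (hA : ContDiffOn ℂ 2 A Ω)
    (hsymm : ∀ z ∈ Ω, ∀ X Y, fderiv ℂ A z X Y = fderiv ℂ A z Y X)
    {u : E → E} (hu : ContDiffOn ℝ 2 u Ω) {d : F} {c : ℂ}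
    (hperp : ∀ z ∈ Ω, ∀ v, ⟪A z v, A z (u z) - d⟫_ℂ = 0)
    (hconst : ∀ z ∈ Ω, ⟪d, A z (u z)⟫_ℂ = c) :
    ∀ z ∈ Ω, fderiv ℝ (fun w => A w (u w)) z = 0 := by
  set T : E → F := fun w => A w (u w) with hT
  have hnhds : ∀ z ∈ Ω, Ω ∈ 𝓝 z := fun z hz => hΩ.mem_nhds hz
  have hA1 : ∀ z ∈ Ω, DifferentiableAt ℂ A z := fun z hz =>
    (hA.contDiffAt (hnhds z hz)).differentiableAt (by norm_num)
  have hA2 : ∀ z ∈ Ω, DifferentiableAt ℂ (fderiv ℂ A) z := fun z hz =>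
    ((hA.contDiffAt (hnhds z hz)).fderiv_right (m := 1) (by norm_num)).differentiableAt
      (by norm_num)
  have hu2 : ∀ z ∈ Ω, ContDiffAt ℝ 2 u z := fun z hz => hu.contDiffAt (hnhds z hz)
  have hu1 : ∀ z ∈ Ω, DifferentiableAt ℝ u z := fun z hz =>
    (hu2 z hz).differentiableAt (by norm_num)
  have hT2 : ∀ z ∈ Ω, ContDiffAt ℝ 2 T z := by
    intro z hz
    have h1 : ContDiffAt ℂ 2 (fun p : E × E => A p.1 p.2) (z, u z) :=
      (ContDiffAt.comp (𝕜 := ℂ) (z, u z) (hA.contDiffAt (hnhds z hz)) contDiffAt_fst).clm_apply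
        contDiffAt_snd
    exact (h1.restrict_scalars ℝ).comp z (contDiffAt_id.prodMk (hu2 z hz))
  have hT1 : ∀ z ∈ Ω, DifferentiableAt ℝ T z := fun z hz =>
    (hT2 z hz).differentiableAt (by norm_num)
  have hAv : ∀ z ∈ Ω, ∀ v, DifferentiableAt ℝ (fun w => A w v) z := fun z hz v =>
    (hA1 z hz).clm_apply_real (differentiableAt_const v)
  have dA : ∀ z ∈ Ω, ∀ v X, wirtinger (fun w => A w v) z X = fderiv ℂ A z X v := by
    intro z hz v X
    simpa [wirtinger_const] using
      wirtinger_clm_apply (hA1 z hz) (differentiableAt_const v) X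
  have dbA : ∀ z ∈ Ω, ∀ v X, wirtingerBar (fun w => A w v) z X = 0 := by
    intro z hz v X
    simpa [wirtingerBar_const] using
      wirtingerBar_clm_apply (hA1 z hz) (differentiableAt_const v) X
  have dT : ∀ z ∈ Ω, ∀ X, wirtinger T z X = fderiv ℂ A z X (u z) + A z (wirtinger u z X) :=
    fun z hz X => wirtinger_clm_apply (hA1 z hz) (hu1 z hz) X
  have dbT : ∀ z ∈ Ω, ∀ X, wirtingerBar T z X = A z (wirtingerBar u z X) :=
    fun z hz X => wirtingerBar_clm_apply (hA1 z hz) (hu1 z hz) X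
  -- the holomorphic part of the derivative of `T` is normal
  have hnormal : ∀ z ∈ Ω, ∀ X v, ⟪A z v, wirtinger T z X⟫_ℂ = 0 := by
    intro z hz X v
    have := inner_wirtinger_add_eq_zero (hAv z hz v) ((hT1 z hz).sub_const d)
      (eventually_of_mem (hnhds z hz) fun w hw => hperp w hw v) X
    rwa [wirtinger_sub_const, dbA z hz, inner_zero_left, add_zero] at this
  have hshape : ∀ z ∈ Ω, ∀ X v,
      ⟪A z v, wirtingerBar T z X⟫_ℂ = -⟪fderiv ℂ A z X v, T z - d⟫_ℂ := by
    intro z hz X v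
    have := inner_wirtingerBar_add_eq_zero (hAv z hz v) ((hT1 z hz).sub_const d)
      (eventually_of_mem (hnhds z hz) fun w hw => hperp w hw v) X
    rw [wirtingerBar_sub_const, dA z hz] at this
    exact eq_neg_of_add_eq_zero_left this
  have hshape_symm : ∀ z ∈ Ω, ∀ X v,
      ⟪A z v, wirtingerBar T z X⟫_ℂ = ⟪A z X, wirtingerBar T z v⟫_ℂ := by
    intro z hz X v
    rw [hshape z hz, hshape z hz, hsymm z hz]
  -- Constancy of `⟨d, T⟩` makes `∂̄_X T` orthogonal to `d`; being tangent, it is also orthogonal to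
  -- `T - d`.
  have hTbar : ∀ z ∈ Ω, ∀ X, ⟪T z, wirtingerBar T z X⟫_ℂ = 0 := by
    intro z hz X
    have h1 := inner_wirtingerBar_add_eq_zero (differentiableAt_const d) (hT1 z hz)
      (eventually_of_mem (hnhds z hz) hconst) X
    rw [wirtinger_const, inner_zero_left, add_zero] at h1
    have h2 := hperp z hz (wirtingerBar u z X)
    rw [← dbT z hz] at h2
    have h3 := inner_eq_zero_symm.1 h2
    rwa [inner_sub_left, h1, sub_zero] at h3
  have hnorm : ∀ z ∈ Ω, ∀ X,
      ⟪wirtinger T z X, wirtinger T z X⟫_ℂ = ⟪wirtingerBar T z X, wirtingerBar T z X⟫_ℂ := by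
    intro z hz X
    -- The vector `u z` is frozen here. Then `(∂_X A)(u z)` differs from `∂_X T` by a tangent
    -- vector, so its product with the normal vector `∂_X T` is `‖∂_X T‖²`.
    have h1 := inner_wirtingerBar_add_eq_zero (hAv z hz (u z))
      (DifferentiableAt.wirtinger (hT2 z hz) X)
      (eventually_of_mem (hnhds z hz) fun w hw => hnormal w hw X (u z)) X
    have h2 := inner_wirtinger_add_eq_zero (hT1 z hz) (DifferentiableAt.wirtingerBar (hT2 z hz) X)
      (eventually_of_mem (hnhds z hz) fun w hw => hTbar w hw X) X
    rw [wirtinger_wirtingerBar_comm (hT2 z hz)] at h2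
    rw [dA z hz, eq_sub_of_add_eq (dT z hz X).symm, inner_sub_left, hnormal z hz] at h1
    linear_combination h1 - h2
  have hbar_zero : ∀ z ∈ Ω, ∀ X, (∀ v, ⟪A z v, wirtingerBar T z X⟫_ℂ = 0) →
      wirtingerBar T z X = 0 ∧ wirtinger T z X = 0 := by
    intro z hz X h
    have h1 : wirtingerBar T z X = 0 := by
      rw [← inner_self_eq_zero (𝕜 := ℂ)]
      nth_rewrite 1 [dbT z hz]
      exact h _
    refine ⟨h1, ?_⟩
    rw [← inner_self_eq_zero (𝕜 := ℂ), hnorm z hz, h1, inner_zero_left]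
  -- With `X = u z` the symmetric form becomes `⟨A u, ∂̄_v T⟩ = ⟨T, ∂̄_v T⟩ = 0`.
  have hzero : ∀ z ∈ Ω, wirtinger T z (u z) = 0 := by
    intro z hz
    refine (hbar_zero z hz (u z) fun v => ?_).2
    rw [hshape_symm z hz]
    exact hTbar z hz v
  intro z hz
  have hmain : ∀ X, wirtingerBar T z X = 0 ∧ wirtinger T z X = 0 := by
    intro X
    set Y := wirtingerBar u z X with hY
    have hDu : DifferentiableAt ℝ (fderiv ℝ u) z :=
      ((hu2 z hz).fderiv_right (m := 1) (by norm_num)).differentiableAt (by norm_num)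
    have hu1z := hu1 z hz
    have hw : DifferentiableAt ℝ (fun w => -wirtinger u w (u w)) z := by
      unfold wirtinger
      fun_prop
    -- This is `∂_u T = 0` as an identity of functions. Applying `∂̄_X` yields, by symmetry of `∂A`,
    -- twice `(∂_Y A) u` on the left and a tangent vector on the right.
    have heq : (fun w => fderiv ℂ A w (u w) (u w)) =ᶠ[𝓝 z]
        fun w => A w (-wirtinger u w (u w)) := by
      refine eventually_of_mem (hnhds z hz) fun w hw => ?_
      have h := hzero w hw
      rw [dT w hw] at h
      simpa using eq_neg_of_add_eq_zero_left h
    have h1 := wirtingerBar_clm_apply₂ (hA2 z hz) (hu1 z hz) (hu1 z hz) X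
    rw [wirtingerBar, heq.fderiv_eq, ← wirtingerBar, wirtingerBar_clm_apply (hA1 z hz) hw,
      hsymm z hz (u z), ← hY, ← two_smul ℂ] at h1
    -- Now `∂_Y T` is tangent as well as normal.
    have h2 : wirtinger T z Y = 0 := by
      rw [← inner_self_eq_zero (𝕜 := ℂ)]
      nth_rewrite 1 [dT z hz]
      rw [inner_add_left, hnormal z hz, add_zero,
        ← inv_smul_smul₀ (two_ne_zero (α := ℂ)) (fderiv ℂ A z Y (u z)), ← h1, ← map_smul,
        hnormal z hz]
    have h3 : wirtingerBar T z Y = 0 := by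
      rw [← inner_self_eq_zero (𝕜 := ℂ), ← hnorm z hz, h2, inner_zero_left]
    -- Since `∂̄_X T = A Y`, symmetry gives `‖∂̄_X T‖² = ⟨A X, ∂̄_Y T⟩`.
    have h4 : wirtingerBar T z X = 0 := by
      rw [← inner_self_eq_zero (𝕜 := ℂ)]
      nth_rewrite 1 [dbT z hz]
      rw [hshape_symm z hz, h3, inner_zero_right]
    refine ⟨h4, ?_⟩
    rw [← inner_self_eq_zero (𝕜 := ℂ), hnorm z hz, h4, inner_zero_left]
  ext X
  rw [← wirtinger_add_wirtingerBar, (hmain X).1, (hmain X).2]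
  simp

/-! ### Projection to a varying tangent space -/

/-- The coordinates `(A⋆A)⁻¹ A⋆ d` of the orthogonal projection of `d` to the range of `A`. -/
def projCoords {E F : Type*} [NormedAddCommGroup E] [InnerProductSpace ℂ E] [CompleteSpace E]
    [NormedAddCommGroup F] [InnerProductSpace ℂ F] [CompleteSpace F] (A : E →L[ℂ] F) (d : F) : E :=
  Ring.inverse (A.adjoint ∘L A) (A.adjoint d)

section Projection

variable {E F : Type u} [NormedAddCommGroup E] [InnerProductSpace ℂ E] [FiniteDimensional ℂ E]
  [NormedAddCommGroup F] [InnerProductSpace ℂ F] [FiniteDimensional ℂ F]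
  [CompleteSpace E] [CompleteSpace F]

omit [FiniteDimensional ℂ F] in
theorem isUnit_adjoint_comp_self {A : E →L[ℂ] F} (hA : Function.Injective A) :
    IsUnit (A.adjoint ∘L A) := by
  have hinj : Function.Injective (A.adjoint ∘L A).toLinearMap := by
    rw [injective_iff_map_eq_zero]
    intro x hx
    have h : ⟪A x, A x⟫_ℂ = 0 := by
      rw [← ContinuousLinearMap.adjoint_inner_left]
      have : A.adjoint (A x) = 0 := hx
      rw [this, inner_zero_left]
    exact (injective_iff_map_eq_zero A).1 hA x (inner_self_eq_zero.1 h)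
  let e := (LinearEquiv.ofInjectiveEndo _ hinj).toContinuousLinearEquiv
  exact ⟨ContinuousLinearEquiv.toUnit e, by ext x; rfl⟩

omit [FiniteDimensional ℂ F] in
theorem apply_projCoords_eq_starProjection {A : E →L[ℂ] F} (hA : Function.Injective A) (d : F) :
    A (projCoords A d) = (LinearMap.range A.toLinearMap).starProjection d := by
  refine (Submodule.eq_starProjection_of_mem_of_inner_eq_zero
    (LinearMap.mem_range_self A.toLinearMap _) ?_).symm
  rintro _ ⟨v, rfl⟩
  have h : (A.adjoint ∘L A) (projCoords A d) = A.adjoint d := by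
    rw [projCoords, ← mul_apply_eq_comp,
      Ring.mul_inverse_cancel _ (isUnit_adjoint_comp_self hA), one_apply_eq_self]
  have h' : A.adjoint (d - A (projCoords A d)) = 0 := by
    rw [map_sub, ← h]
    simp
  have := ContinuousLinearMap.adjoint_inner_left A v (d - A (projCoords A d))
  rw [h', inner_zero_left] at this
  exact this.symm

-- Smoothness is only over `ℝ` because the adjoint is conjugate-linear.
omit [FiniteDimensional ℂ F] in
theorem contDiffOn_projCoords {A : E → E →L[ℂ] F} {Ω : Set E} (hA : ContDiffOn ℂ 2 A Ω)
    (hinj : ∀ z ∈ Ω, Function.Injective (A z)) (d : F) :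
    ContDiffOn ℝ 2 (fun z => projCoords (A z) d) Ω := by
  have h1 : ContDiffOn ℝ 2 A Ω := hA.restrict_scalars ℝ
  have hadj : ContDiff ℝ 2 (fun L : E →L[ℂ] F => L.adjoint) := by
    let adj : (E →L[ℂ] F) →ₗ[ℝ] (F →L[ℂ] E) :=
      { toFun := fun L => L.adjoint
        map_add' := fun L L' => map_add _ L L'
        map_smul' := fun t L => by
          have := map_smulₛₗ (ContinuousLinearMap.adjoint (𝕜 := ℂ) (E := E) (F := F)) (t : ℂ) L
          simpa using this }
    exact (adj.mkContinuous 1 fun L => by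
      rw [one_mul]
      exact (LinearIsometryEquiv.norm_map ContinuousLinearMap.adjoint L).le).contDiff
  have h2 : ContDiffOn ℝ 2 (fun z => (A z).adjoint) Ω := hadj.comp_contDiffOn h1
  have h3 : ContDiffOn ℝ 2 (fun z => (A z).adjoint ∘L A z) Ω := by
    have h : ContDiff ℂ 2 (fun p : (F →L[ℂ] E) × (E →L[ℂ] F) => p.1 ∘L p.2) :=
      contDiff_fst.clm_comp contDiff_snd
    exact (h.restrict_scalars ℝ).comp_contDiffOn (h2.prodMk h1)
  have h4 : ContDiffOn ℝ 2 (fun z => Ring.inverse ((A z).adjoint ∘L A z)) Ω := by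
    intro z hz
    obtain ⟨x, hx⟩ := isUnit_adjoint_comp_self (hinj z hz)
    have := contDiffAt_ringInverse ℂ (n := 2) x
    rw [hx] at this
    exact (this.restrict_scalars ℝ).comp_contDiffWithinAt z (h3 z hz)
  have h5 : ContDiffOn ℝ 2 (fun z => (A z).adjoint d) Ω := by
    have h : ContDiff ℂ 2 (fun L : F →L[ℂ] E => L d) := contDiff_id.clm_apply contDiff_const
    exact (h.restrict_scalars ℝ).comp_contDiffOn h2
  have h6 : ContDiff ℂ 2 (fun p : (E →L[ℂ] E) × E => p.1 p.2) := contDiff_fst.clm_apply contDiff_snd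
  exact (h6.restrict_scalars ℝ).comp_contDiffOn (h4.prodMk h5)

open Metric in
/-- If the tangential component of `d` has constant length along a holomorphic immersion, then it
is constant. -/
theorem starProjection_range_fderiv_eq {g : E → F} {z₀ : E} {r : ℝ}
    (hg : DifferentiableOn ℂ g (ball z₀ r))
    (hinj : ∀ z ∈ ball z₀ r, Function.Injective (fderiv ℂ g z)) {d : F} {c : ℝ}
    (hc : ∀ z ∈ ball z₀ r, ‖(LinearMap.range (fderiv ℂ g z).toLinearMap).starProjection d‖ = c)
    {z w : E} (hz : z ∈ ball z₀ r) (hw : w ∈ ball z₀ r) :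
    (LinearMap.range (fderiv ℂ g z).toLinearMap).starProjection d =
      (LinearMap.range (fderiv ℂ g w).toLinearMap).starProjection d := by
  have hΩ : IsOpen (ball z₀ r) := isOpen_ball
  have hA := (hg.differentiableOn_fderiv hΩ).contDiffOn_nat hΩ 2
  have hu := contDiffOn_projCoords hA hinj d
  have hg3 := hg.contDiffOn_nat hΩ 2
  have key := fderiv_tangential_eq_zero hΩ hA (fun z hz X Y =>
      ((hg3.contDiffAt (hΩ.mem_nhds hz)).isSymmSndFDerivAt (by simp)).eq X Y) hu (d := d)
      (c := (c ^ 2 : ℝ)) (fun z hz v => ?_) (fun z hz => ?_)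
  · have hd : DifferentiableOn ℝ (fun w => fderiv ℂ g w (projCoords (fderiv ℂ g w) d))
        (ball z₀ r) := fun z hz => by
      refine (DifferentiableAt.clm_apply_real ?_ ?_).differentiableWithinAt
      · exact (hA.contDiffAt (hΩ.mem_nhds hz)).differentiableAt (by norm_num)
      · exact (hu.contDiffAt (hΩ.mem_nhds hz)).differentiableAt (by norm_num)
    have := (convex_ball z₀ r).is_const_of_fderivWithin_eq_zero (𝕜 := ℝ) hd (fun x hx => by
      rw [fderivWithin_of_isOpen hΩ hx, key x hx]) hz hw
    simpa only [apply_projCoords_eq_starProjection (hinj z hz),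
      apply_projCoords_eq_starProjection (hinj w hw)] using this
  · rw [apply_projCoords_eq_starProjection (hinj z hz)]
    have := Submodule.starProjection_inner_eq_zero (K := LinearMap.range (fderiv ℂ g z).toLinearMap)
      d (fderiv ℂ g z v) ⟨v, rfl⟩
    rw [← neg_sub, inner_neg_right, inner_eq_zero_symm.1 this, neg_zero]
  · rw [apply_projCoords_eq_starProjection (hinj z hz), ← hc z hz]
    have h := Submodule.starProjection_inner_eq_zero
      (K := LinearMap.range (fderiv ℂ g z).toLinearMap) d _
      (Submodule.starProjection_apply_mem _ d)
    rw [inner_sub_left, sub_eq_zero] at h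
    rw [h, inner_self_eq_norm_sq_to_K]
    simp

end Projection

/-! ### Helices on the manifold: the axis is tangent -/

theorem real_inner_eq_re_inner_complex {k : ℕ} (x y : CSpace k) : ⟪x, y⟫_ℝ = (⟪x, y⟫_ℂ).re := by
  simp [PiLp.inner_apply, Complex.inner]

theorem norm_starProjection_eq_cos_tangentAngle_mul {m n : ℕ} {M : Type*} [TopologicalSpace M]
    [ChartedSpace (CSpace m) M] (f : M → CSpace n) (d : CSpace n) (p : M) :
    ‖(tangentImage m f p).starProjection d‖ = Real.cos (tangentAngle m f d p) * ‖d‖ := by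
  set T := (tangentImage m f p).starProjection d with hT
  by_cases h0 : T = 0
  · simp [tangentAngle, ← hT, h0]
  have h := Submodule.starProjection_inner_eq_zero (K := tangentImage m f p) d T
    (Submodule.starProjection_apply_mem _ d)
  rw [← hT, inner_sub_left, sub_eq_zero, inner_self_eq_norm_sq_to_K] at h
  have h1 := InnerProductGeometry.cos_angle_mul_norm_mul_norm d T
  have h2 : ⟪d, T⟫_ℝ = ‖T‖ ^ 2 := by
    rw [real_inner_eq_re_inner_complex, h]
    norm_cast
  rw [h2] at h1
  rw [tangentAngle, ← hT]
  have h3 : ‖T‖ ≠ 0 := norm_ne_zero_iff.2 h0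
  apply mul_right_cancel₀ h3
  linarith

section Chart

variable {m n : ℕ} {M : Type*} [TopologicalSpace M]
  [ChartedSpace (CSpace m) M] [IsManifold 𝓘(ℂ, CSpace m) ω M] {f : M → CSpace n}

theorem differentiableOn_comp_chartAt_symm (hf : MDifferentiable 𝓘(ℂ, CSpace m) 𝓘(ℂ, CSpace n) f)
    (p : M) : DifferentiableOn ℂ (f ∘ (chartAt (CSpace m) p).symm)
      (chartAt (CSpace m) p).target := by
  have : IsManifold 𝓘(ℂ, CSpace m) 1 M := .of_le (n := ω) (by simp)
  rw [← mdifferentiableOn_iff_differentiableOn]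
  exact hf.comp_mdifferentiableOn (mdifferentiableOn_atlas_symm (chart_mem_atlas _ p))

theorem mfderiv_eq_fderiv_comp_mfderiv_chartAt
    (hf : MDifferentiable 𝓘(ℂ, CSpace m) 𝓘(ℂ, CSpace n) f) {p q : M}
    (hq : q ∈ (chartAt (CSpace m) p).source) :
    (mfderiv 𝓘(ℂ, CSpace m) 𝓘(ℂ, CSpace n) f q : CSpace m →L[ℂ] CSpace n) =
      fderiv ℂ (f ∘ (chartAt (CSpace m) p).symm) (chartAt (CSpace m) p q) ∘L
        (mfderiv 𝓘(ℂ, CSpace m) 𝓘(ℂ, CSpace m) (chartAt (CSpace m) p) q :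
          CSpace m →L[ℂ] CSpace m) := by
  have : IsManifold 𝓘(ℂ, CSpace m) 1 M := .of_le (n := ω) (by simp)
  set e := chartAt (CSpace m) p
  have hg : MDifferentiableAt 𝓘(ℂ, CSpace m) 𝓘(ℂ, CSpace n) (f ∘ e.symm) (e q) :=
    ((differentiableOn_comp_chartAt_symm hf p).differentiableAt
      (e.open_target.mem_nhds (e.map_source hq))).mdifferentiableAt
  have he : MDifferentiableAt 𝓘(ℂ, CSpace m) 𝓘(ℂ, CSpace m) e q :=
    mdifferentiableAt_atlas (chart_mem_atlas _ p) hq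
  have h := mfderiv_comp q hg he
  rw [mfderiv_eq_fderiv] at h
  refine Eq.trans ?_ h
  refine EventuallyEq.mfderiv_eq ?_
  filter_upwards [e.open_source.mem_nhds hq] with x hx
  simp [e.left_inv hx]

/-- The differential of a chart is onto, so composing with it does not change the range. -/
theorem tangentImage_eq_range_fderiv (hf : MDifferentiable 𝓘(ℂ, CSpace m) 𝓘(ℂ, CSpace n) f)
    {p q : M} (hq : q ∈ (chartAt (CSpace m) p).source) :
    tangentImage m f q = LinearMap.range
      (fderiv ℂ (f ∘ (chartAt (CSpace m) p).symm) (chartAt (CSpace m) p q)).toLinearMap := by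
  have : IsManifold 𝓘(ℂ, CSpace m) 1 M := .of_le (n := ω) (by simp)
  have hs := (mdifferentiable_chart (I := 𝓘(ℂ, CSpace m)) p).range_mfderiv_eq_top hq
  rw [tangentImage, mfderiv_eq_fderiv_comp_mfderiv_chartAt hf hq]
  exact LinearMap.range_comp_of_range_eq_top _ hs

theorem injective_fderiv_comp_chartAt_symm (hf : IsHolomorphicImmersion m f) {p : M} {z : CSpace m}
    (hz : z ∈ (chartAt (CSpace m) p).target) :
    Function.Injective (fderiv ℂ (f ∘ (chartAt (CSpace m) p).symm) z) := by
  have : IsManifold 𝓘(ℂ, CSpace m) 1 M := .of_le (n := ω) (by simp)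
  set e := chartAt (CSpace m) p
  have hq := e.map_target hz
  have hs := (mdifferentiable_chart (I := 𝓘(ℂ, CSpace m)) p).mfderiv_surjective hq
  have h := hf.injective_mfderiv (e.symm z)
  have h1 := mfderiv_eq_fderiv_comp_mfderiv_chartAt hf.holomorphic hq
  rw [e.right_inv hz] at h1
  have h2 : ⇑(mfderiv 𝓘(ℂ, CSpace m) 𝓘(ℂ, CSpace n) f (e.symm z)) = _ := congrArg DFunLike.coe h1
  rw [h2] at h
  exact Function.Injective.of_comp_right h hs

/-- The tangential component of the axis of a helix is locally constant. -/
theorem IsHelix.isLocallyConstant_starProjection (hf : IsHolomorphicImmersion m f) {d : CSpace n}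
    {θ : ℝ} (hhelix : IsHelix m f d θ) :
    IsLocallyConstant fun p => (tangentImage m f p).starProjection d := by
  rw [IsLocallyConstant.iff_eventually_eq]
  intro p
  set e := chartAt (CSpace m) p
  have hp : p ∈ e.source := mem_chart_source _ p
  obtain ⟨r, hr, hball⟩ := Metric.isOpen_iff.1 e.open_target (e p) (e.map_source hp)
  have hg := differentiableOn_comp_chartAt_symm hf.holomorphic p
  have hN : e.source ∩ e ⁻¹' Metric.ball (e p) r ∈ 𝓝 p :=
    (e.isOpen_inter_preimage Metric.isOpen_ball).mem_nhds ⟨hp, Metric.mem_ball_self hr⟩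
  filter_upwards [hN] with q hq
  simp only [tangentImage_eq_range_fderiv hf.holomorphic hq.1,
    tangentImage_eq_range_fderiv hf.holomorphic hp]
  refine starProjection_range_fderiv_eq (c := Real.cos θ * ‖d‖) (hg.mono hball)
    (fun z hz => injective_fderiv_comp_chartAt_symm hf (hball hz)) (fun z hz => ?_) hq.2
    (Metric.mem_ball_self hr)
  have h := tangentImage_eq_range_fderiv hf.holomorphic (e.map_target (hball hz))
  rw [e.right_inv (hball hz)] at h
  simp only [← h]
  rw [norm_starProjection_eq_cos_tangentAngle_mul, hhelix]

theorem isLocallyConstant_inner_of_orthogonal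
    (hf : MDifferentiable 𝓘(ℂ, CSpace m) 𝓘(ℂ, CSpace n) f) {w : CSpace n}
    (hw : ∀ p, ∀ v ∈ tangentImage m f p, ⟪w, v⟫_ℂ = 0) :
    IsLocallyConstant fun p => ⟪w, f p⟫_ℂ := by
  rw [IsLocallyConstant.iff_eventually_eq]
  intro p
  set e := chartAt (CSpace m) p with he
  have hp : p ∈ e.source := mem_chart_source _ p
  obtain ⟨r, hr, hball⟩ := Metric.isOpen_iff.1 e.open_target (e p) (e.map_source hp)
  have hg := differentiableOn_comp_chartAt_symm hf p
  have hd : ∀ z ∈ Metric.ball (e p) r, HasFDerivAt (fun z => innerSL ℂ w ((f ∘ e.symm) z))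
      (0 : CSpace m →L[ℂ] ℂ) z := by
    intro z hz
    have h1 := (innerSL ℂ w).hasFDerivAt.comp z
      (hg.differentiableAt (e.open_target.mem_nhds (hball hz))).hasFDerivAt
    have ht := tangentImage_eq_range_fderiv hf (e.map_target (hball hz))
    rw [e.right_inv (hball hz)] at ht
    have h2 : innerSL ℂ w ∘L fderiv ℂ (f ∘ e.symm) z = 0 := ContinuousLinearMap.ext fun v =>
      hw (e.symm z) _ (by rw [ht]; exact ⟨v, rfl⟩)
    rw [← h2]
    exact h1
  have hN : e.source ∩ e ⁻¹' Metric.ball (e p) r ∈ 𝓝 p :=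
    (e.isOpen_inter_preimage Metric.isOpen_ball).mem_nhds ⟨hp, Metric.mem_ball_self hr⟩
  filter_upwards [hN] with q hq
  have := (convex_ball (e p) r).is_const_of_fderivWithin_eq_zero (𝕜 := ℂ)
    (fun z hz => (hd z hz).differentiableAt.differentiableWithinAt) (fun z hz => by
      rw [fderivWithin_of_isOpen Metric.isOpen_ball hz, (hd z hz).fderiv]) hq.2
    (Metric.mem_ball_self hr)
  simpa [e.left_inv hq.1, e.left_inv hp] using this

/-- The axis of a full complex helix is tangent to it. -/
theorem IsHelix.mem_tangentImage [ConnectedSpace M] (hf : IsHolomorphicImmersion m f)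
    (hfull : IsFull f) {d : CSpace n} {θ : ℝ} (hhelix : IsHelix m f d θ) (p : M) :
    d ∈ tangentImage m f p := by
  have hT := hhelix.isLocallyConstant_starProjection hf
  set w := d - (tangentImage m f p).starProjection d with hw
  have hperp : ∀ q, ∀ v ∈ tangentImage m f q, ⟪w, v⟫_ℂ = 0 := by
    intro q v hv
    rw [hw, hT.apply_eq_of_isPreconnected isPreconnected_univ (Set.mem_univ p) (Set.mem_univ q)]
    exact Submodule.starProjection_inner_eq_zero d v hv
  have hconst := isLocallyConstant_inner_of_orthogonal hf.holomorphic hperp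
  -- The image lies in the affine subspace through `f p` orthogonal to `w`; fullness leaves only `w
  -- = 0`.
  have htop := hfull (AffineSubspace.mk' (f p) (ℂ ∙ w)ᗮ) (by
    rintro _ ⟨q, rfl⟩
    rw [SetLike.mem_coe, AffineSubspace.mem_mk', Submodule.mem_orthogonal_singleton_iff_inner_right,
      vsub_eq_sub, inner_sub_right, sub_eq_zero]
    exact hconst.apply_eq_of_isPreconnected isPreconnected_univ (Set.mem_univ q) (Set.mem_univ p))
  have hdir := congrArg AffineSubspace.direction htop
  rw [AffineSubspace.direction_mk', AffineSubspace.direction_top, Submodule.orthogonal_eq_top_iff,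
    Submodule.span_singleton_eq_bot, hw, sub_eq_zero] at hdir
  rw [hdir]
  exact Submodule.starProjection_apply_mem _ d

theorem IsHelix.angle_eq_zero [ConnectedSpace M] (hf : IsHolomorphicImmersion m f)
    (hfull : IsFull f) {d : CSpace n} (hd : d ≠ 0) {θ : ℝ} (hhelix : IsHelix m f d θ) :
    θ = 0 := by
  obtain ⟨p⟩ := ‹ConnectedSpace M›.toNonempty
  rw [← hhelix p, tangentAngle,
    Submodule.starProjection_eq_self_iff.2 (hhelix.mem_tangentImage hf hfull p)]
  exact InnerProductGeometry.angle_self hd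

end Chart

/-! ### Rotating the axis, and the local product structure -/

theorem exists_orthonormalBasis_norm_smul_eq {U : Type*} [NormedAddCommGroup U]
    [InnerProductSpace ℂ U] [FiniteDimensional ℂ U] {k : ℕ} (hk : Module.finrank ℂ U = k) {z : U}
    (hz : z ≠ 0) (i₀ : Fin k) :
    ∃ b : OrthonormalBasis (Fin k) ℂ U, (‖z‖ : ℂ) • b i₀ = z := by
  have hz' : (‖z‖ : ℂ) ≠ 0 := by exact_mod_cast norm_ne_zero_iff.2 hz
  obtain ⟨b, hb⟩ := Orthonormal.exists_orthonormalBasis_extension_of_card_eq (𝕜 := ℂ)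
    (by simpa using hk) (v := fun _ : Fin k => ((‖z‖ : ℂ)⁻¹) • z) (s := {i₀})
    ⟨fun i => by simp [norm_smul, hz], fun i j hij => (hij (Subsingleton.elim i j)).elim⟩
  exact ⟨b, by rw [hb i₀ rfl, smul_inv_smul₀ hz']⟩

/-- Two nonzero vectors of the same length in inner product spaces of the same dimension are
exchanged by a linear isometry. -/
theorem exists_linearIsometryEquiv_apply_eq {V V' : Type*} [NormedAddCommGroup V]
    [InnerProductSpace ℂ V] [FiniteDimensional ℂ V] [NormedAddCommGroup V']
    [InnerProductSpace ℂ V'] [FiniteDimensional ℂ V']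
    (hdim : Module.finrank ℂ V = Module.finrank ℂ V') {x : V} {y : V'} (hx : x ≠ 0)
    (hxy : ‖x‖ = ‖y‖) : ∃ ψ : V ≃ₗᵢ[ℂ] V', ψ x = y := by
  have hy : y ≠ 0 := norm_ne_zero_iff.1 (hxy ▸ norm_ne_zero_iff.2 hx)
  let i₀ : Fin (Module.finrank ℂ V) := ⟨0, Module.finrank_pos_iff_exists_ne_zero.2 ⟨x, hx⟩⟩
  obtain ⟨b, hb⟩ := exists_orthonormalBasis_norm_smul_eq rfl hx i₀
  obtain ⟨b', hb'⟩ := exists_orthonormalBasis_norm_smul_eq hdim.symm hy i₀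
  refine ⟨b.equiv b' (Equiv.refl _), ?_⟩
  rw [← hb, map_smul, b.equiv_apply_basis, Equiv.refl_apply, hxy, hb']

open Metric in
/-- A holomorphic immersion into `ℂ × H` which is everywhere tangent to the first factor is, in
suitable coordinates, of the form `(s, w) ↦ (s, κ w)`. -/
theorem exists_adapted_chart {E H : Type} [NormedAddCommGroup E] [InnerProductSpace ℂ E]
    [FiniteDimensional ℂ E] [NormedAddCommGroup H] [InnerProductSpace ℂ H] [FiniteDimensional ℂ H]
    {Ω : Set E} (hΩ : IsOpen Ω) {G : E → ℂ × H} (hG : DifferentiableOn ℂ G Ω)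
    (hinj : ∀ z ∈ Ω, Function.Injective (fderiv ℂ G z))
    (hvert : ∀ z ∈ Ω, ∃ u, fderiv ℂ G z u = (1, 0)) {z₀ : E} (hz₀ : z₀ ∈ Ω) :
    ∃ (W : Submodule ℂ H) (D : Set ℂ) (B : Set W) (κ : W → H)
      (e : OpenPartialHomeomorph E (ℂ × W)),
      Module.finrank ℂ W + 1 = Module.finrank ℂ E ∧ IsOpen D ∧ IsOpen B ∧ z₀ ∈ e.source ∧
      e.source ⊆ Ω ∧ e.target = D ×ˢ B ∧
      (∀ z ∈ e.source, e z = ((G z).1, W.orthogonalProjectionOnto (G z).2)) ∧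
      DifferentiableOn ℂ κ B ∧ (∀ w ∈ B, W.orthogonalProjectionOnto (κ w) = w) ∧
      ∀ z ∈ e.source, (G z).2 = κ (W.orthogonalProjectionOnto (G z).2) := by
  have := FiniteDimensional.complete ℂ E
  have := FiniteDimensional.complete ℂ H
  let k' : E → (E →L[ℂ] H) := fun z => ContinuousLinearMap.snd ℂ ℂ H ∘L fderiv ℂ G z
  -- As `(1, 0)` is tangent, the tangent space at `z₀` is exactly `ℂ × W`, so `P ∘ G` has invertible
  -- differential there.
  let W : Submodule ℂ H := LinearMap.range (k' z₀).toLinearMap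
  let P : ℂ × H →L[ℂ] ℂ × W :=
    (ContinuousLinearMap.fst ℂ ℂ H).prod (W.orthogonalProjectionOnto ∘L ContinuousLinearMap.snd ℂ ℂ H)
  have hPG : ∀ z ∈ Ω, HasFDerivAt (fun z => P (G z)) (P ∘L fderiv ℂ G z) z := fun z hz =>
    P.hasFDerivAt.comp z (hG.differentiableAt (hΩ.mem_nhds hz)).hasFDerivAt
  have hbij : Function.Bijective (P ∘L fderiv ℂ G z₀) := by
    constructor
    · rw [injective_iff_map_eq_zero]
      intro v hv
      have h1 : (fderiv ℂ G z₀ v).1 = 0 := congrArg Prod.fst hv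
      have h2 : W.orthogonalProjectionOnto (fderiv ℂ G z₀ v).2 = 0 := congrArg Prod.snd hv
      have h3 : (fderiv ℂ G z₀ v).2 ∈ W := ⟨v, rfl⟩
      have h4 : (fderiv ℂ G z₀ v).2 = 0 := by
        rw [← Submodule.starProjection_eq_self_iff.2 h3, Submodule.starProjection_apply, h2]
        rfl
      exact (injective_iff_map_eq_zero _).1 (hinj z₀ hz₀) v (Prod.ext h1 h4)
    · rintro ⟨s, ⟨_, v, rfl⟩⟩
      obtain ⟨u, hu⟩ := hvert z₀ hz₀
      refine ⟨v + (s - (fderiv ℂ G z₀ v).1) • u, ?_⟩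
      have h3 : (fderiv ℂ G z₀ v).2 ∈ W := ⟨v, rfl⟩
      refine Prod.ext ?_ ?_
      · simp [P, hu]
      · have h4 : (P (fderiv ℂ G z₀ (v + (s - (fderiv ℂ G z₀ v).1) • u))).2 =
            W.orthogonalProjectionOnto (fderiv ℂ G z₀ v).2 := by
          simp [P, hu]
        exact h4.trans (Submodule.orthogonalProjectionOnto_mem_subspace_eq_self (K := W) ⟨_, h3⟩)
  let L : E ≃L[ℂ] ℂ × W :=
    (LinearEquiv.ofBijective (P ∘L fderiv ℂ G z₀).toLinearMap hbij).toContinuousLinearEquiv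
  have hL : HasFDerivAt (fun z => P (G z)) (L : E →L[ℂ] ℂ × W) z₀ := hPG z₀ hz₀
  have hGc : ContDiffAt ℂ 1 G z₀ := (hG.contDiffOn_nat hΩ 1).contDiffAt (hΩ.mem_nhds hz₀)
  have hPGc : ContDiffAt ℂ 1 (fun z => P (G z)) z₀ := P.contDiff.contDiffAt.comp z₀ hGc
  let e₀ := hPGc.toOpenPartialHomeomorph _ hL one_ne_zero
  have hz₀e : z₀ ∈ e₀.source := hPGc.mem_toOpenPartialHomeomorph_source hL one_ne_zero
  have hsymm : ContDiffAt ℂ 1 e₀.symm (e₀ z₀) := hPGc.to_localInverse hL one_ne_zero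
  have hev : ∀ᶠ y in 𝓝 (e₀ z₀), ContDiffAt ℂ 1 e₀.symm y := hsymm.eventually (by simp)
  have hevΩ : ∀ᶠ y in 𝓝 (e₀ z₀), e₀.symm y ∈ Ω :=
    hsymm.continuousAt.eventually_mem (by rw [e₀.left_inv hz₀e]; exact hΩ.mem_nhds hz₀)
  obtain ⟨ρ, hρ, hball⟩ := Metric.eventually_nhds_iff_ball.1
    (hev.and (hevΩ.and (e₀.open_target.eventually_mem (e₀.map_source hz₀e))))
  set D := ball (e₀ z₀).1 ρ
  set B := ball (e₀ z₀).2 ρ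
  -- The sup norm on `ℂ × W` makes a ball a product of balls; convexity of `D` is used for
  -- `hKconst`.
  have hDB : D ×ˢ B = ball (e₀ z₀) ρ := ball_prod_same _ _ _
  have hmem : ∀ s ∈ D, ∀ w ∈ B, (s, w) ∈ ball (e₀ z₀) ρ := fun s hs w hw => hDB ▸ ⟨hs, hw⟩
  let K : ℂ × W → H := fun y => (G (e₀.symm y)).2
  have hK : ∀ y ∈ ball (e₀ z₀) ρ, HasFDerivAt K
      (k' (e₀.symm y) ∘L fderiv ℂ e₀.symm y) y := fun y hy =>
    ((ContinuousLinearMap.snd ℂ ℂ H).hasFDerivAt.comp _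
      (hG.differentiableAt (hΩ.mem_nhds (hball y hy).2.1)).hasFDerivAt).comp y
      ((hball y hy).1.differentiableAt one_ne_zero).hasFDerivAt
  -- The inverse chart carries the coordinate vector `(1, 0)` to the `u` with `dG u = (1, 0)`, whose
  -- second component is zero.
  have hK0 : ∀ y ∈ ball (e₀ z₀) ρ, (k' (e₀.symm y) ∘L fderiv ℂ e₀.symm y) (1, 0) = 0 := by
    intro y hy
    obtain ⟨u, hu⟩ := hvert _ (hball y hy).2.1
    have hcomp : HasFDerivAt (fun z => e₀.symm (e₀ z))
        (fderiv ℂ e₀.symm y ∘L (P ∘L fderiv ℂ G (e₀.symm y))) (e₀.symm y) := by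
      refine HasFDerivAt.comp _ ?_ (hPG _ (hball y hy).2.1)
      have : P (G (e₀.symm y)) = y := e₀.right_inv (hball y hy).2.2
      rw [show e₀ (e₀.symm y) = y from this]
      exact ((hball y hy).1.differentiableAt one_ne_zero).hasFDerivAt
    have hid : HasFDerivAt (fun z => e₀.symm (e₀ z)) (ContinuousLinearMap.id ℂ E) (e₀.symm y) :=
      (hasFDerivAt_id _).congr_of_eventuallyEq
        (e₀.eventually_left_inverse (e₀.map_target (hball y hy).2.2))
    have h1 := congrArg (fun L => L u) (hcomp.unique hid)
    have h2 : fderiv ℂ e₀.symm y (1, 0) = u := by simpa [hu, P] using h1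
    rw [ContinuousLinearMap.comp_apply, h2]
    simp [k', hu]
  have hKconst : ∀ s ∈ D, ∀ w ∈ B, K (s, w) = K ((e₀ z₀).1, w) := by
    intro s hs w hw
    have hd : ∀ t ∈ D, HasFDerivAt (fun t : ℂ => K (t, w)) (0 : ℂ →L[ℂ] H) t := by
      intro t ht
      have h1 := HasFDerivAt.comp (𝕜 := ℂ) t (hK _ (hmem t ht w hw)) (hasFDerivAt_prodMk_left t w)
      have h2 : (k' (e₀.symm (t, w)) ∘L fderiv ℂ e₀.symm (t, w)) ∘L
          ContinuousLinearMap.inl ℂ ℂ W = 0 :=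
        ContinuousLinearMap.ext_ring (hK0 _ (hmem t ht w hw))
      rw [h2] at h1
      exact h1
    exact (convex_ball (e₀ z₀).1 ρ).is_const_of_fderivWithin_eq_zero (𝕜 := ℂ)
      (f := fun t : ℂ => K (t, w))
      (fun t ht => (hd t ht).differentiableAt.differentiableWithinAt)
      (fun t ht => by rw [fderivWithin_of_isOpen isOpen_ball ht, (hd t ht).fderiv]) hs
      (mem_ball_self hρ)
  have hD₀ : (e₀ z₀).1 ∈ D := mem_ball_self hρ
  have hB₀ : (e₀ z₀).2 ∈ B := mem_ball_self hρ
  let e := (e₀.symm.restrOpen (D ×ˢ B) (isOpen_ball.prod isOpen_ball)).symm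
  have htarget : e.target = D ×ˢ B :=
    Set.inter_eq_right.2 fun y hy => (hball y (hmem _ hy.1 _ hy.2)).2.2
  have hsource : ∀ z ∈ e.source, z ∈ e₀.source ∧ e₀ z ∈ D ×ˢ B := fun z hz =>
    ⟨hz.1, htarget ▸ e.map_source hz⟩
  refine ⟨W, D, B, fun w => K ((e₀ z₀).1, w), e, ?_, isOpen_ball,
    isOpen_ball, ?_, ?_, htarget, fun z _ => rfl, ?_, ?_, ?_⟩
  · rw [L.toLinearEquiv.finrank_eq, Module.finrank_prod, Module.finrank_self, add_comm]
  · have h1 : e₀ z₀ ∈ e.target := htarget ▸ ⟨hD₀, hB₀⟩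
    have h2 := e.map_target h1
    rwa [show e.symm (e₀ z₀) = z₀ from e₀.left_inv hz₀e] at h2
  · intro z hz
    obtain ⟨h1, h2⟩ := hsource z hz
    rw [← e₀.left_inv h1]
    exact (hball _ (hmem _ h2.1 _ h2.2)).2.1
  · intro w hw
    exact ((hK _ (hmem _ hD₀ w hw)).comp w
      (hasFDerivAt_prodMk_right _ w)).differentiableAt.differentiableWithinAt
  · intro w hw
    exact congrArg Prod.snd (e₀.right_inv (hball _ (hmem _ hD₀ w hw)).2.2)
  · intro z hz
    obtain ⟨h1, h2⟩ := hsource z hz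
    have h3 := hKconst _ h2.1 _ h2.2
    rw [show K ((e₀ z).1, (e₀ z).2) = (G z).2 from congrArg (fun x => (G x).2) (e₀.left_inv h1)]
      at h3
    exact h3

/-- The image of a holomorphic section of a linear projection is a complex submanifold. -/
theorem isComplexSubmanifold_image_of_section {r : ℕ} {W : Submodule ℂ (CSpace r)} {B : Set W}
    (hB : IsOpen B) {π : CSpace r →L[ℂ] W} (hπ : ∀ w : W, π w = w) {κ : W → CSpace r}
    (hκ : DifferentiableOn ℂ κ B) (hsec : ∀ w ∈ B, π (κ w) = w) :
    IsComplexSubmanifold (Module.finrank ℂ W) (κ '' B) := by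
  have hdiff : DifferentiableOn ℂ (fun x => κ (π x)) (π ⁻¹' B) :=
    hκ.comp π.differentiable.differentiableOn fun x hx => hx
  have hdiff' : DifferentiableOn ℂ (fun x => (π x : CSpace r)) (π ⁻¹' B) :=
    (W.subtypeL ∘L π).differentiable.differentiableOn
  -- A shear along the fibres of `π`: each fibre is translated so that `κ w` moves to `w`.
  let Φ : OpenPartialHomeomorph (CSpace r) (CSpace r) :=
    { toFun := fun x => x - κ (π x) + π x
      invFun := fun x => x + κ (π x) - π x
      source := π ⁻¹' B
      target := π ⁻¹' B
      map_source' := fun x hx => by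
        simpa [hsec _ hx, hπ] using hx
      map_target' := fun x hx => by
        simpa [hsec _ hx, hπ] using hx
      left_inv' := fun x hx => by
        simp only [map_add, map_sub, hsec _ hx, hπ, sub_self, zero_add]
        abel
      right_inv' := fun x hx => by
        simp only [map_add, map_sub, hsec _ hx, hπ, add_sub_cancel_right]
        abel
      open_source := hB.preimage π.continuous
      open_target := hB.preimage π.continuous
      continuousOn_toFun := ((differentiableOn_id.sub hdiff).add hdiff').continuousOn
      continuousOn_invFun := ((differentiableOn_id.add hdiff).sub hdiff').continuousOn }
  rintro _ ⟨w, hw, rfl⟩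
  refine ⟨Φ, ?_, (differentiableOn_id.sub hdiff).add hdiff',
    (differentiableOn_id.add hdiff).sub hdiff', W, rfl, ?_⟩
  · show π (κ w) ∈ B
    rwa [hsec w hw]
  · ext y
    constructor
    · rintro ⟨_, ⟨hx, v, hv, rfl⟩, rfl⟩
      refine ⟨Φ.map_source hx, ?_⟩
      simp [Φ, hsec v hv]
    · rintro ⟨hy, hyW⟩
      lift y to W using hyW
      have hyB : y ∈ B := by simpa [Φ, hπ] using hy
      refine ⟨κ y, ⟨?_, y, hyB, rfl⟩, ?_⟩
      · show π (κ y) ∈ B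
        rwa [hsec y hyB]
      · simp [Φ, hsec y hyB]

/-- An immersed complex submanifold which is everywhere tangent to `d` is locally an extrinsic
product. -/
theorem exists_nhds_extrinsicProduct {m n r : ℕ} {M : Type*} [TopologicalSpace M]
    [ChartedSpace (CSpace m) M] [IsManifold 𝓘(ℂ, CSpace m) ω M]
    {f : M → CSpace n} (hf : IsHolomorphicImmersion m f) {d : CSpace n} {c : ℂ} (hc : c ≠ 0)
    (ψ : CSpace n ≃ₗᵢ[ℂ] CProd r) (hψ : ψ d = WithLp.toLp 2 (c, 0))
    (hd : ∀ p, d ∈ tangentImage m f p) (p : M) :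
    ∃ U : Set M, IsOpen U ∧ p ∈ U ∧ Topology.IsEmbedding (U.domRestrict f) ∧
      ∃ (D : Set ℂ) (N : Set (CSpace r)), IsOpen D ∧ IsComplexSubmanifold (m - 1) N ∧
        ψ '' (f '' U) = extrinsicProduct D N := by
  set φ := chartAt (CSpace m) p with hφ
  have hp : p ∈ φ.source := mem_chart_source _ p
  let Q : CSpace n ≃L[ℂ] ℂ × CSpace r :=
    ψ.toContinuousLinearEquiv.trans (WithLp.prodContinuousLinearEquiv 2 ℂ ℂ (CSpace r))
  have hg := differentiableOn_comp_chartAt_symm hf.holomorphic p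
  have hQg : ∀ z ∈ φ.target, HasFDerivAt (fun z => Q (f (φ.symm z)))
      ((Q : CSpace n →L[ℂ] ℂ × CSpace r) ∘L fderiv ℂ (f ∘ φ.symm) z) z := fun z hz =>
    (Q : CSpace n →L[ℂ] ℂ × CSpace r).hasFDerivAt.comp z
      (hg.differentiableAt (φ.open_target.mem_nhds hz)).hasFDerivAt
  obtain ⟨W, D, B, κ, e, hdim, hD, hB, hpe, heφ, htarget, he, hκ, hsec, hgraph⟩ :=
    exists_adapted_chart (H := CSpace r) (G := fun z => Q (f (φ.symm z))) φ.open_target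
      (fun z hz => (hQg z hz).differentiableAt.differentiableWithinAt)
      (fun z hz => by
        rw [(hQg z hz).fderiv]
        exact Q.injective.comp (injective_fderiv_comp_chartAt_symm hf hz))
      (fun z hz => by
        have ht := tangentImage_eq_range_fderiv hf.holomorphic (φ.map_target hz)
        rw [φ.right_inv hz] at ht
        obtain ⟨v, hv⟩ : d ∈ LinearMap.range (fderiv ℂ (f ∘ φ.symm) z).toLinearMap :=
          ht ▸ hd (φ.symm z)
        have hQd : Q d = (c, 0) := by
          show (WithLp.prodContinuousLinearEquiv 2 ℂ ℂ (CSpace r)) (ψ d) = (c, 0)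
          rw [hψ]
          rfl
        refine ⟨c⁻¹ • v, ?_⟩
        rw [(hQg z hz).fderiv, map_smul]
        show c⁻¹ • Q (fderiv ℂ (f ∘ φ.symm) z v) = _
        rw [show fderiv ℂ (f ∘ φ.symm) z v = d from hv, hQd]
        simp [hc])
      (φ.map_source hp)
  let χ := φ.trans e
  have hχ : ∀ q ∈ χ.source, q ∈ φ.source ∧ φ q ∈ e.source := fun q hq => by
    simpa [χ, OpenPartialHomeomorph.trans_source] using hq
  have hχQ : ∀ q ∈ χ.source, χ q = ((Q (f q)).1, W.orthogonalProjectionOnto (Q (f q)).2) := by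
    intro q hq
    have h := he (φ q) (hχ q hq).2
    simp only [φ.left_inv (hχ q hq).1] at h
    exact h
  have hχκ : ∀ q ∈ χ.source, (Q (f q)).2 = κ (χ q).2 := by
    intro q hq
    have h := hgraph (φ q) (hχ q hq).2
    simp only [φ.left_inv (hχ q hq).1] at h
    rw [hχQ q hq]
    exact h
  have hχtarget : χ.target = D ×ˢ B := by
    rw [OpenPartialHomeomorph.trans_target, htarget]
    refine Set.inter_eq_left.2 fun y hy => heφ (e.map_target (htarget ▸ hy))
  refine ⟨χ.source, χ.open_source, ?_, ?_, D, κ '' B, hD, ?_, ?_⟩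
  · simpa [χ, OpenPartialHomeomorph.trans_source] using ⟨hp, hpe⟩
  -- On `χ.source` the chart `χ` factors through `f`; since it is an embedding, so is `f`.
  · let P : ℂ × CSpace r → ℂ × W := Prod.map id W.orthogonalProjectionOnto
    have hP : Continuous P := continuous_id.prodMap W.orthogonalProjectionOnto.continuous
    have hcomp : (P ∘ Q) ∘ χ.source.domRestrict f = χ.source.domRestrict χ :=
      funext fun q => (hχQ q q.2).symm
    have hemb : Topology.IsEmbedding (χ.source.domRestrict χ) :=
      χ.isEmbedding_restrict
    rw [← hcomp] at hemb
    exact .of_comp (hf.holomorphic.continuous.continuousOn.domRestrict) (hP.comp Q.continuous) hemb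
  · have := isComplexSubmanifold_image_of_section hB (π := W.orthogonalProjectionOnto)
      Submodule.orthogonalProjectionOnto_mem_subspace_eq_self hκ hsec
    rw [finrank_euclideanSpace_fin] at hdim
    rwa [← hdim, Nat.add_sub_cancel]
  · ext y
    constructor
    · rintro ⟨_, ⟨q, hq, rfl⟩, rfl⟩
      have h1 : χ q ∈ D ×ˢ B := hχtarget ▸ χ.map_source hq
      have h2 : (χ q).1 = (ψ (f q)).fst := congrArg Prod.fst (hχQ q hq)
      exact ⟨h2 ▸ h1.1, (χ q).2, h1.2, (hχκ q hq).symm⟩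
    · rintro ⟨hyD, w, hw, hyw⟩
      have hy : (y.fst, w) ∈ χ.target := hχtarget ▸ ⟨hyD, hw⟩
      have hq := χ.map_target hy
      refine ⟨_, ⟨_, hq, rfl⟩, ?_⟩
      have h1 := hχQ _ hq
      have h2 := hχκ _ hq
      rw [χ.right_inv hy] at h1 h2
      have h3 : y.fst = (ψ (f (χ.symm (y.fst, w)))).fst :=
        (congrArg Prod.fst h1 :)
      have h4 : (ψ (f (χ.symm (y.fst, w)))).snd = κ w := h2
      refine (WithLp.prodContinuousLinearEquiv 2 ℂ ℂ (CSpace r)).injective (Prod.ext h3.symm ?_)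
      exact h4.trans hyw

/-! ### The theorem -/

theorem mainTheorem2 {m n : ℕ} {M : Type*} [TopologicalSpace M] [ConnectedSpace M]
    [ChartedSpace (CSpace m) M] [IsManifold 𝓘(ℂ, CSpace m) ω M]
    (f : M → CSpace n) (hf : IsHolomorphicImmersion m f) (hfull : IsFull f)
    (d : CSpace n) (hd : d ≠ 0) (θ : ℝ) (hhelix : IsHelix m f d θ) :
    θ = 0 ∧
    ∃ ψ : CSpace n ≃ₗᵢ[ℂ] CProd (n - 1),
      ψ d = WithLp.toLp 2 ((‖d‖ : ℂ), (0 : CSpace (n - 1))) ∧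
      ∃ k : ℕ, k + 1 = m ∧
        ∀ p : M, ∃ U : Set M, IsOpen U ∧ p ∈ U ∧ Topology.IsEmbedding (U.domRestrict f) ∧
          ∃ (D : Set ℂ) (N : Set (CSpace (n - 1))),
            IsOpen D ∧ IsComplexSubmanifold k N ∧
            ψ '' (f '' U) = extrinsicProduct D N := by
  have hmem := hhelix.mem_tangentImage hf hfull
  have hn : n ≠ 0 := by
    rintro rfl
    exact hd (Subsingleton.elim _ _)
  have hm : m ≠ 0 := by
    rintro rfl
    obtain ⟨p⟩ := ‹ConnectedSpace M›.toNonempty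
    obtain ⟨v, hv⟩ := hmem p
    have hv0 : v = 0 := Subsingleton.elim (α := CSpace 0) _ _
    exact hd (hv.symm.trans ((congrArg _ hv0).trans (map_zero _)))
  have hdim : Module.finrank ℂ (CSpace n) = Module.finrank ℂ (CProd (n - 1)) := by
    rw [(WithLp.linearEquiv 2 ℂ (ℂ × CSpace (n - 1))).finrank_eq, Module.finrank_prod,
      finrank_euclideanSpace_fin, finrank_euclideanSpace_fin, Module.finrank_self]
    omega
  obtain ⟨ψ, hψ⟩ := exists_linearIsometryEquiv_apply_eq hdim hd
    (y := WithLp.toLp 2 ((‖d‖ : ℂ), (0 : CSpace (n - 1)))) (by simp)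
  exact ⟨hhelix.angle_eq_zero hf hfull hd, ψ, hψ, m - 1, Nat.succ_pred_eq_of_ne_zero hm,
    exists_nhds_extrinsicProduct hf (by exact_mod_cast norm_ne_zero_iff.2 hd) ψ hψ hmem⟩

end
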